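/- Let $N\ge 1$, and for a smooth scalar field $f:\mathbb{R}^N\to\mathbb{R}$ put $$\|f\|_{\mathcal D}:=\Big(\int_{\mathbb{R}^N}f^2\,dx+\int_{\mathbb{R}^N}f^2|x|^2\,dx+\int_{\mathbb{R}^N}|\nabla f|^2\,dx\Big)^{1/2}\in[0,\infty].$$ Let $\mathbb{S}^{N-1}$ be the unit sphere of $\mathbb{R}^N$ and $\mathrm{d}\sigma$ its surface measure (the counting measure on $\{\pm1\}$ if $N=1$). Suppose that $f\in C^\infty(\mathbb{R}^N)$ satisfies $\|f\|_{\mathcal D}<\infty$, $$\int_{\mathbb{S}^{N-1}}f(r\sigma)\,\mathrm{d}\sigma=0\quad\text{for all } r>0,\qquad\text{and}\qquad \int_{\mathbb{S}^{N-1}}f(R\sigma)^2\,\mathrm{d}\sigma=o(R^{-N})\quad\text{as } R\to\infty.$$ Then $$\int_{\mathbb{R}^N}|\nabla f|^2\,dx\int_{\mathbb{R}^N}f^2|x|^2\,dx\ \ge\ \Big(\frac{N+2}{2}\Big)^2\Big(\int_{\mathbb{R}^N}f^2\,dx\Big)^2 .$$ Moreover, for all constants $B_0>0$ and $B_1,\dots,B_N\in\mathbb{R}$,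 the function $f(x)=\sum_{k=1}^N B_kx_k\,e^{-B_0|x|^2}$ satisfies all the above hypotheses, and equality holds for it. -/

import Mathlib

open MeasureTheory Filter Asymptotics
open scoped ENNReal ContDiff Gradient

noncomputable section

/-- Euclidean space `ℝ^N`. -/
abbrev RN (N : ℕ) : Type := EuclideanSpace ℝ (Fin N)

/-- The integral `∫_{S^{N-1}} g(σ) dσ` with respect to the surface measure of the unit sphere. -/
def sphereIntegral {N : ℕ} (g : RN N → ℝ) : ℝ :=
  ∫ σ : Metric.sphere (0 : RN N) 1, g σ ∂((volume : Measure (RN N)).toSphere)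

/-- `‖f‖_D = (∫ |f|² + ∫ |f|² |x|² + ∫ |∇f|²)^{1/2}`, as an element of `[0, ∞]`. -/
def normD {N : ℕ} (f : RN N → ℝ) : ℝ≥0∞ :=
  ((∫⁻ x, ‖f x‖ₑ ^ 2) + (∫⁻ x, ‖f x‖ₑ ^ 2 * ‖x‖ₑ ^ 2) + ∫⁻ x, ‖∇ f x‖ₑ ^ 2) ^ (1 / 2 : ℝ)

/-- Smooth scalar fields with finite `D`-norm, zero mean on every sphere centred at the origin,
and `∫_{S^{N-1}} f(Rσ)² dσ = o(R^{-N})` as `R → ∞`. -/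
structure IsTestField {N : ℕ} (f : RN N → ℝ) : Prop where
  smooth : ContDiff ℝ ∞ f
  normD_lt_top : normD f < ⊤
  zero_mean : ∀ r : ℝ, 0 < r → sphereIntegral (fun σ => f (r • σ)) = 0
  decay : (fun R : ℝ => sphereIntegral (fun σ => f (R • σ) ^ 2)) =o[atTop]
    fun R : ℝ => R ^ (-(N : ℤ))

/-- The profile `(B₁ x₁ + ⋯ + B_N x_N) e^{-B₀ |x|²}`. -/
def gaussProfile {N : ℕ} (B₀ : ℝ) (B : Fin N → ℝ) (x : RN N) : ℝ :=
  (∑ k, B k * x k) * Real.exp (-B₀ * ‖x‖ ^ 2)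

end

/-!
The inequality is the spectral gap of the harmonic oscillator in disguise. A function with zero
mean on every sphere centred at the origin is orthogonal to every Gaussian, so `g = f e^{|x|²/4}`
has mean zero for the standard Gaussian measure `γ` and the Gaussian Poincaré inequality
`∫ g² dγ ≤ ∫ |∇g|² dγ` reads `∫ f² ≤ ∫ |∇f + (f/2) x|²`. Expanding the square and integrating
`f ⟪∇f, x⟫` by parts against the Euler field gives
`(N+2)/2 ∫ f² ≤ ∫ |∇f|² + 1/4 ∫ f²|x|²`; applying this to the dilates of `f` turns it into a
nonnegative quadratic polynomial, whose discriminant is the product inequality.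

The Poincaré inequality itself follows by tensorization (Efron–Stein) from dimension one. There one
may assume that `u` vanishes at the mean `m`, and integrating the derivative of `u² w / (x - m)`,
with `w` the Gaussian density, exhibits the deficit as the integral of a square.
-/

section Variance

open ProbabilityTheory

variable {Ω Ω' : Type*} [MeasurableSpace Ω] [MeasurableSpace Ω'] {μ : Measure Ω} {ν : Measure Ω'}

theorem enorm_integral_sq_le_lintegral {F : Type*} [NormedAddCommGroup F] [NormedSpace ℝ F]
    [IsProbabilityMeasure μ] (X : Ω → F) : ‖∫ x, X x ∂μ‖ₑ ^ 2 ≤ ∫⁻ x, ‖X x‖ₑ ^ 2 ∂μ := by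
  by_cases hX : Integrable X μ
  · calc ‖∫ x, X x ∂μ‖ₑ ^ 2 ≤ eLpNorm X 1 μ ^ 2 := by
          rw [eLpNorm_one_eq_lintegral_enorm]
          gcongr
          exact enorm_integral_le_lintegral_enorm X
      _ ≤ eLpNorm X 2 μ ^ 2 := by
          gcongr
          exact eLpNorm_le_eLpNorm_of_exponent_le one_le_two hX.1
      _ = ∫⁻ x, ‖X x‖ₑ ^ 2 ∂μ := by
          simpa using eLpNorm_nnreal_pow_eq_lintegral (f := X) (μ := μ) (p := 2) two_ne_zero
  · simp [integral_undef hX]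

theorem lintegral_enorm_sq_eq_evariance_add [IsProbabilityMeasure μ] {X : Ω → ℝ}
    (hX : AEStronglyMeasurable X μ) :
    ∫⁻ x, ‖X x‖ₑ ^ 2 ∂μ = evariance X μ + ‖∫ x, X x ∂μ‖ₑ ^ 2 := by
  have hsq : ENNReal.ofReal ((∫ x, X x ∂μ) ^ 2) = ‖∫ x, X x ∂μ‖ₑ ^ 2 := by
    rw [← enorm_pow, Real.enorm_of_nonneg (sq_nonneg _)]
  rw [evariance_def' hX, hsq, tsub_add_cancel_of_le (enorm_integral_sq_le_lintegral X)]

theorem memLp_two_iff_lintegral_enorm_sq_lt_top {X : Ω → ℝ} (hX : AEStronglyMeasurable X μ) :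
    MemLp X 2 μ ↔ ∫⁻ x, ‖X x‖ₑ ^ 2 ∂μ < ⊤ := by
  have hsq : AEStronglyMeasurable (fun x => X x ^ 2) μ := hX.pow 2
  simp [memLp_two_iff_integrable_sq hX, Integrable, hsq, hasFiniteIntegral_iff_enorm]

theorem evariance_le_lintegral_sub_const [IsProbabilityMeasure μ] {X : Ω → ℝ}
    (hX : AEStronglyMeasurable X μ) (c : ℝ) : evariance X μ ≤ ∫⁻ x, ‖X x - c‖ₑ ^ 2 ∂μ := by
  rcases eq_top_or_lt_top (∫⁻ x, ‖X x - c‖ₑ ^ 2 ∂μ) with htop | hfin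
  · simp [htop]
  have hXc : AEStronglyMeasurable (fun x => X x - c) μ := hX.sub aestronglyMeasurable_const
  have hint : Integrable (fun x => X x - c) μ :=
    ((memLp_two_iff_lintegral_enorm_sq_lt_top hXc).2 hfin).integrable one_le_two
  have hint' : Integrable X μ := by
    simpa [Pi.add_def] using hint.add (integrable_const c)
  calc evariance X μ = evariance (fun x => X x - c) μ := by
        simp [evariance, integral_sub hint' (integrable_const c)]
    _ ≤ ∫⁻ x, ‖X x - c‖ₑ ^ 2 ∂μ := by
        rw [lintegral_enorm_sq_eq_evariance_add hXc]
        exact le_self_add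

theorem evariance_comp_measurePreserving {φ : Ω → Ω'} (hφ : MeasurePreserving φ μ ν) {X : Ω' → ℝ}
    (hX : Measurable X) : evariance (X ∘ φ) μ = evariance X ν := by
  have hmean : ∫ x, X (φ x) ∂μ = ∫ y, X y ∂ν := by
    rw [← hφ.map_eq, integral_map hφ.aemeasurable hX.aestronglyMeasurable]
  have hdev : Measurable fun y => ‖X y - ∫ y', X y' ∂ν‖ₑ ^ 2 := by fun_prop
  simp only [evariance, Function.comp_apply, hmean]
  exact hφ.lintegral_comp hdev

variable [IsProbabilityMeasure μ] [IsProbabilityMeasure ν]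

theorem measurable_evariance_prodMk_left {g : Ω × Ω' → ℝ} (hg : Measurable g) :
    Measurable fun x => evariance (fun y => g (x, y)) ν := by
  have hmean : Measurable fun x => ∫ y, g (x, y) ∂ν :=
    hg.stronglyMeasurable.integral_prod_right'.measurable
  have hdev : Measurable fun z : Ω × Ω' => ‖g z - ∫ y, g (z.1, y) ∂ν‖ₑ ^ 2 :=
    (hg.sub (hmean.comp measurable_fst)).enorm.pow_const 2
  exact hdev.lintegral_prod_right'

theorem evariance_prod_eq {g : Ω × Ω' → ℝ} (hg : MemLp g 2 (μ.prod ν)) :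
    evariance g (μ.prod ν) = (∫⁻ y, evariance (fun x => g (x, y)) μ ∂ν) +
      evariance (fun y => ∫ x, g (x, y) ∂μ) ν := by
  have hmean : AEStronglyMeasurable (fun y => ∫ x, g (x, y) ∂μ) ν :=
    hg.1.prod_swap.integral_prod_right'
  have hgrand : ∫ y, ∫ x, g (x, y) ∂μ ∂ν = ∫ z, g z ∂μ.prod ν :=
    (integral_prod_symm _ (hg.integrable one_le_two)).symm
  have hsections : ∀ᵐ y ∂ν, AEStronglyMeasurable (fun x => g (x, y)) μ := by
    filter_upwards [(hg.integrable one_le_two).prod_left_ae] with y hy using hy.1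
  have hfin : ‖∫ z, g z ∂μ.prod ν‖ₑ ^ 2 ≠ ⊤ := by simp
  refine (ENNReal.add_left_inj hfin).1 ?_
  calc evariance g (μ.prod ν) + ‖∫ z, g z ∂μ.prod ν‖ₑ ^ 2
      = ∫⁻ y, ∫⁻ x, ‖g (x, y)‖ₑ ^ 2 ∂μ ∂ν := by
        rw [← lintegral_enorm_sq_eq_evariance_add hg.1, lintegral_prod_symm]
        exact hg.1.enorm.pow_const 2
    _ = ∫⁻ y, (evariance (fun x => g (x, y)) μ + ‖∫ x, g (x, y) ∂μ‖ₑ ^ 2) ∂ν := by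
        refine lintegral_congr_ae ?_
        filter_upwards [hsections] with y hy using lintegral_enorm_sq_eq_evariance_add hy
    _ = _ := by
        rw [lintegral_add_right' _ (hmean.enorm.pow_const 2),
          lintegral_enorm_sq_eq_evariance_add hmean, hgrand, add_assoc]

theorem evariance_integral_le {g : Ω × Ω' → ℝ} (hg : Integrable g (μ.prod ν)) :
    evariance (fun y => ∫ x, g (x, y) ∂μ) ν ≤ ∫⁻ x, evariance (fun y => g (x, y)) ν ∂μ := by
  have hmean : Integrable (fun x => ∫ y, g (x, y) ∂ν) μ := hg.integral_prod_left
  have hdev : AEMeasurable (fun z : Ω' × Ω => ‖g z.swap - ∫ y, g (z.2, y) ∂ν‖ₑ ^ 2)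
      (ν.prod μ) := by
    have := hg.1.prod_swap.sub hmean.1.comp_snd
    exact this.enorm.pow_const 2
  calc evariance (fun y => ∫ x, g (x, y) ∂μ) ν
      = ∫⁻ y, ‖∫ x, (g (x, y) - ∫ y', g (x, y') ∂ν) ∂μ‖ₑ ^ 2 ∂ν := by
        refine lintegral_congr_ae ?_
        filter_upwards [hg.prod_left_ae] with y hy
        rw [integral_sub hy hmean, integral_integral_swap (f := fun x y => g (x, y)) hg]
    _ ≤ ∫⁻ y, ∫⁻ x, ‖g (x, y) - ∫ y', g (x, y') ∂ν‖ₑ ^ 2 ∂μ ∂ν :=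
        lintegral_mono fun _ => enorm_integral_sq_le_lintegral _
    _ = ∫⁻ x, evariance (fun y => g (x, y)) ν ∂μ := lintegral_lintegral_swap hdev

theorem evariance_prod_le {g : Ω × Ω' → ℝ} (hg : MemLp g 2 (μ.prod ν)) :
    evariance g (μ.prod ν) ≤ (∫⁻ y, evariance (fun x => g (x, y)) μ ∂ν) +
      ∫⁻ x, evariance (fun y => g (x, y)) ν ∂μ := by
  rw [evariance_prod_eq hg]
  gcongr
  exact evariance_integral_le (hg.integrable one_le_two)

variable {n : ℕ} {Ω : Fin n → Type*} [∀ i, MeasurableSpace (Ω i)] {μ : ∀ i, Measure (Ω i)}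
  [∀ i, IsProbabilityMeasure (μ i)]

theorem measurable_evariance_update {g : (∀ i, Ω i) → ℝ} (hg : Measurable g) (i : Fin n) :
    Measurable fun x => evariance (fun s => g (Function.update x i s)) (μ i) :=
  measurable_evariance_prodMk_left (g := fun p : (∀ i, Ω i) × Ω i => g (Function.update p.1 i p.2))
    (hg.comp measurable_update')

theorem lintegral_pi_lintegral_update (i : Fin n) {F : (∀ i, Ω i) → ℝ≥0∞} (hF : Measurable F) :
    ∫⁻ x, ∫⁻ s, F (Function.update x i s) ∂μ i ∂Measure.pi μ = ∫⁻ x, F x ∂Measure.pi μ := by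
  have hinner : Measurable fun x => ∫⁻ s, F (Function.update x i s) ∂μ i := by
    exact (hF.comp measurable_update').lintegral_prod_right'
  refine lintegral_eq_of_lmarginal_eq {i} hinner hF ?_
  ext x
  simp [lmarginal_singleton, Function.update_idem]

theorem measurePreserving_fin_insertNth {n : ℕ} {Ω : Fin (n + 1) → Type*}
    [∀ i, MeasurableSpace (Ω i)] (μ : ∀ i, Measure (Ω i)) [∀ i, SigmaFinite (μ i)]
    (i : Fin (n + 1)) :
    MeasurePreserving (fun p : Ω i × (∀ j, Ω (i.succAbove j)) => i.insertNth (α := Ω) p.1 p.2)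
      ((μ i).prod (Measure.pi fun j => μ (i.succAbove j))) (Measure.pi μ) :=
  (measurePreserving_piFinSuccAbove μ i).symm

theorem lintegral_pi_eq_lintegral_insertNth {n : ℕ} {Ω : Fin (n + 1) → Type*}
    [∀ i, MeasurableSpace (Ω i)] (μ : ∀ i, Measure (Ω i)) [∀ i, SigmaFinite (μ i)]
    (i : Fin (n + 1)) {F : (∀ i, Ω i) → ℝ≥0∞} (hF : Measurable F) :
    ∫⁻ x, F x ∂Measure.pi μ =
      ∫⁻ t, ∫⁻ y, F (i.insertNth t y) ∂Measure.pi (fun j => μ (i.succAbove j)) ∂μ i := by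
  have hpres := measurePreserving_fin_insertNth μ i
  rw [← hpres.lintegral_comp hF]
  exact lintegral_prod _ (hF.comp hpres.measurable).aemeasurable

/-- The Efron–Stein inequality. -/
theorem evariance_pi_le_sum : ∀ {n : ℕ} {Ω : Fin n → Type*} [∀ i, MeasurableSpace (Ω i)]
    {μ : ∀ i, Measure (Ω i)} [∀ i, IsProbabilityMeasure (μ i)] {g : (∀ i, Ω i) → ℝ},
    Measurable g → MemLp g 2 (Measure.pi μ) → evariance g (Measure.pi μ) ≤
      ∑ i, ∫⁻ x, evariance (fun s => g (Function.update x i s)) (μ i) ∂Measure.pi μ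
  | 0, Ω, _, μ, _, g, _, _ => by
    have hconst : g = fun _ => g default := funext fun x => congrArg g (Subsingleton.elim _ _)
    rw [hconst]
    simp [evariance]
  | n + 1, Ω, _, μ, _, g, hg, hL => by
    have hpres := measurePreserving_fin_insertNth μ 0
    have hgins : Measurable fun p : Ω 0 × (∀ j, Ω (Fin.succAbove 0 j)) =>
      g (Fin.insertNth 0 p.1 p.2) := hg.comp hpres.measurable
    have hLins := hL.comp_measurePreserving hpres
    have hsections : ∀ᵐ t ∂μ 0, MemLp (fun y => g (Fin.insertNth 0 t y)) 2
        (Measure.pi fun j => μ (Fin.succAbove 0 j)) := by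
      filter_upwards [hLins.integrable_sq.prod_right_ae] with t ht
      exact (memLp_two_iff_integrable_sq
        (hgins.comp measurable_prodMk_left).aestronglyMeasurable).2 ht
    have hV := measurable_evariance_update (μ := μ) hg
    rw [← evariance_comp_measurePreserving hpres hg, Fin.sum_univ_succAbove _ 0]
    refine (evariance_prod_le hLins).trans (add_le_add (le_of_eq ?_) ?_)
    · simp only [lintegral_pi_eq_lintegral_insertNth μ 0 (hV 0), Fin.update_insertNth,
        lintegral_const, measure_univ, mul_one, Function.comp_apply]
    · have hVins : ∀ j : Fin n, Measurable fun t : Ω 0 => ∫⁻ y, evariance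
          (fun s => g (Function.update (Fin.insertNth 0 t y) (Fin.succAbove 0 j) s))
          (μ (Fin.succAbove 0 j)) ∂Measure.pi fun j => μ (Fin.succAbove 0 j) :=
        fun j => ((hV _).comp hpres.measurable).lintegral_prod_right'
      simp only [lintegral_pi_eq_lintegral_insertNth μ 0 (hV _)]
      rw [← lintegral_finsetSum _ fun j _ => hVins j]
      refine lintegral_mono_ae ?_
      filter_upwards [hsections] with t ht
      simpa only [Fin.insertNth_update, Function.comp_apply] using evariance_pi_le_sum
        (g := fun y => g (Fin.insertNth 0 t y)) (hgins.comp measurable_prodMk_left) ht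

end Variance

section GaussianPoincareReal

open ProbabilityTheory
open scoped NNReal Topology

theorem lintegral_ofReal_le_of_hasDerivAt_le_sub {F F' p q : ℝ → ℝ}
    (hF : ∀ x, HasDerivAt F (F' x) x) (hF' : ∀ x, F' x ≤ p x - q x) (hp : Continuous p)
    (hq : Continuous q) (hp₀ : ∀ x, 0 ≤ p x) (hq₀ : ∀ x, 0 ≤ q x)
    (hbot : ∀ᶠ x in atBot, F x ≤ 0) (htop : ∀ᶠ x in atTop, 0 ≤ F x) :
    ∫⁻ x, ENNReal.ofReal (q x) ≤ ∫⁻ x, ENNReal.ofReal (p x) := by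
  have hcover : AECover volume atTop fun n : ℕ => Set.Icc (-(n : ℝ)) n :=
    aecover_Icc (tendsto_neg_atTop_atBot.comp tendsto_natCast_atTop_atTop)
      tendsto_natCast_atTop_atTop
  refine le_of_tendsto (hcover.lintegral_tendsto_of_countably_generated
    (hq.measurable.ennreal_ofReal.aemeasurable)) ?_
  filter_upwards [(tendsto_neg_atTop_atBot.comp tendsto_natCast_atTop_atTop).eventually hbot,
    tendsto_natCast_atTop_atTop.eventually htop] with n (hneg : F (-n) ≤ 0) hpos
  have hn : -(n : ℝ) ≤ n := by linarith [Nat.cast_nonneg (α := ℝ) n]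
  have hpint := hp.continuousOn.integrableOn_Icc (μ := volume) (a := -(n : ℝ)) (b := n)
  have hqint := hq.continuousOn.integrableOn_Icc (μ := volume) (a := -(n : ℝ)) (b := n)
  have hle : ∫ x in Set.Icc (-(n : ℝ)) n, q x ≤ ∫ x in Set.Icc (-(n : ℝ)) n, p x := by
    have hftc : F n - F (-n) ≤ ∫ x in -(n : ℝ)..n, (p x - q x) :=
      intervalIntegral.sub_le_integral_of_hasDeriv_right_of_le hn
        (fun x _ => (hF x).continuousAt.continuousWithinAt) (fun x _ => (hF x).hasDerivWithinAt)
        (hp.sub hq).continuousOn.integrableOn_Icc (fun x _ => hF' x)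
    rw [intervalIntegral.integral_of_le hn, ← integral_Icc_eq_integral_Ioc,
      integral_sub hpint hqint] at hftc
    linarith
  calc ∫⁻ x in Set.Icc (-(n : ℝ)) n, ENNReal.ofReal (q x)
      = ENNReal.ofReal (∫ x in Set.Icc (-(n : ℝ)) n, q x) :=
        (ofReal_integral_eq_lintegral_ofReal hqint (ae_of_all _ hq₀)).symm
    _ ≤ ENNReal.ofReal (∫ x in Set.Icc (-(n : ℝ)) n, p x) := ENNReal.ofReal_le_ofReal hle
    _ = ∫⁻ x in Set.Icc (-(n : ℝ)) n, ENNReal.ofReal (p x) :=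
        ofReal_integral_eq_lintegral_ofReal hpint (ae_of_all _ hp₀)
    _ ≤ ∫⁻ x, ENNReal.ofReal (p x) := setLIntegral_le_lintegral _ _

variable {m : ℝ} {v : ℝ≥0} {u : ℝ → ℝ}

theorem hasDerivAt_gaussianPDFReal (m : ℝ) (v : ℝ≥0) (x : ℝ) :
    HasDerivAt (gaussianPDFReal m v) (-((x - m) / v) * gaussianPDFReal m v x) x := by
  have hexp : HasDerivAt (fun y : ℝ => -(y - m) ^ 2 / (2 * v)) (-((x - m) / v)) x := by
    convert! (((hasDerivAt_id x).sub_const m).pow 2).neg.div_const (2 * (v : ℝ)) using 1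
    simp only [Nat.cast_ofNat, id_eq, Nat.add_one_sub_one, pow_one, mul_one]
    ring
  rw [gaussianPDFReal_def]
  convert! hexp.exp.const_mul _ using 1
  ring

theorem hasDerivAt_sq_mul_div_sub {w : ℝ → ℝ} {u' : ℝ} (hw : ContinuousAt w m)
    (hu : HasDerivAt u u' m) (hum : u m = 0) :
    HasDerivAt (fun y => u y ^ 2 * w y / (y - m)) (u' ^ 2 * w m) m := by
  rw [hasDerivAt_iff_tendsto_slope]
  refine (((hasDerivAt_iff_tendsto_slope.1 hu).pow 2).mul
    (hw.tendsto.mono_left nhdsWithin_le_nhds)).congr' ?_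
  filter_upwards [self_mem_nhdsWithin] with y hy
  have hym : y - m ≠ 0 := sub_ne_zero.2 hy
  simp only [slope_def_field, hum]
  field_simp
  simp

/-- Hardy's trick: the difference of the two sides is `(u' - u / (x - m))²` times the density. -/
theorem exists_hasDerivAt_sq_mul_gaussianPDFReal_div_sub (hu : Differentiable ℝ u) (hum : u m = 0)
    (x : ℝ) : ∃ d, HasDerivAt (fun y => u y ^ 2 * gaussianPDFReal m v y / (y - m)) d x ∧
      d ≤ (deriv u x ^ 2 - u x ^ 2 / v) * gaussianPDFReal m v x := by
  have hw := hasDerivAt_gaussianPDFReal m v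
  rcases eq_or_ne x m with rfl | hx
  · exact ⟨_, hasDerivAt_sq_mul_div_sub (hw x).continuousAt (hu x).hasDerivAt hum, by simp [hum]⟩
  · have hxm : x - m ≠ 0 := sub_ne_zero.2 hx
    refine ⟨_, (((hu x).hasDerivAt.pow 2).mul (hw x)).div ((hasDerivAt_id x).sub_const m) hxm, ?_⟩
    have hsq : 0 ≤ (deriv u x - u x / (x - m)) ^ 2 * gaussianPDFReal m v x :=
      mul_nonneg (sq_nonneg _) (gaussianPDFReal_nonneg m v x)
    refine le_of_sub_nonneg (hsq.trans_eq ?_)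
    simp only [Pi.pow_apply, Nat.cast_ofNat, Pi.mul_apply]
    field_simp
    ring

theorem lintegral_enorm_sq_gaussianReal (hv : v ≠ 0) {k : ℝ → ℝ} (hk : Measurable k) :
    ∫⁻ x, ‖k x‖ₑ ^ 2 ∂gaussianReal m v =
      ∫⁻ x, ENNReal.ofReal (k x ^ 2 * gaussianPDFReal m v x) := by
  rw [gaussianReal_of_var_ne_zero _ hv,
    lintegral_withDensity_eq_lintegral_mul _ (measurable_gaussianPDF m v) (by fun_prop)]
  refine lintegral_congr fun x => ?_
  rw [Pi.mul_apply, gaussianPDF, ← enorm_pow, Real.enorm_of_nonneg (sq_nonneg _), mul_comm,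
    ENNReal.ofReal_mul (sq_nonneg _)]

theorem lintegral_sq_gaussianReal_le_lintegral_deriv (hv : v ≠ 0) (hu : ContDiff ℝ 1 u)
    (hum : u m = 0) :
    ∫⁻ x, ‖u x‖ₑ ^ 2 ∂gaussianReal m v ≤ v * ∫⁻ x, ‖deriv u x‖ₑ ^ 2 ∂gaussianReal m v := by
  set w := gaussianPDFReal m v
  have hw₀ : ∀ x, 0 ≤ w x := gaussianPDFReal_nonneg m v
  have hw : Continuous w :=
    continuous_iff_continuousAt.2 fun x => (hasDerivAt_gaussianPDFReal m v x).continuousAt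
  have huc : Continuous u := hu.continuous
  have hdu : Continuous (deriv u) := hu.continuous_deriv le_rfl
  choose d hd hle using exists_hasDerivAt_sq_mul_gaussianPDFReal_div_sub (v := v)
    (hu.differentiable one_ne_zero) hum
  have hcmp : ∫⁻ x, ENNReal.ofReal (u x ^ 2 * w x) ≤
      ∫⁻ x, ENNReal.ofReal (v * (deriv u x ^ 2 * w x)) := by
    refine lintegral_ofReal_le_of_hasDerivAt_le_sub (fun x => (hd x).const_mul (v : ℝ))
      (fun x => (mul_le_mul_of_nonneg_left (hle x) v.coe_nonneg).trans_eq ?_) (by fun_prop)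
      (by fun_prop) (fun x => ?_) (fun x => ?_) ?_ ?_
    · simp only [w]
      field_simp
    · exact mul_nonneg v.coe_nonneg (mul_nonneg (sq_nonneg _) (hw₀ x))
    · exact mul_nonneg (sq_nonneg _) (hw₀ x)
    · filter_upwards [eventually_le_atBot m] with x hx
      exact mul_nonpos_of_nonneg_of_nonpos v.coe_nonneg
        (div_nonpos_of_nonneg_of_nonpos (mul_nonneg (sq_nonneg _) (hw₀ x)) (sub_nonpos.2 hx))
    · filter_upwards [eventually_ge_atTop m] with x hx
      exact mul_nonneg v.coe_nonneg
        (div_nonneg (mul_nonneg (sq_nonneg _) (hw₀ x)) (sub_nonneg.2 hx))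
  rw [lintegral_enorm_sq_gaussianReal hv huc.measurable,
    lintegral_enorm_sq_gaussianReal hv hdu.measurable, ← ENNReal.ofReal_coe_nnreal,
    ← lintegral_const_mul _ (by fun_prop)]
  simpa only [ENNReal.ofReal_mul v.coe_nonneg] using hcmp

theorem evariance_gaussianReal_le_lintegral_deriv (m : ℝ) (v : ℝ≥0) (hu : ContDiff ℝ 1 u) :
    evariance u (gaussianReal m v) ≤ v * ∫⁻ x, ‖deriv u x‖ₑ ^ 2 ∂gaussianReal m v := by
  rcases eq_or_ne v 0 with rfl | hv
  · simp [evariance]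
  calc evariance u (gaussianReal m v) ≤ ∫⁻ x, ‖u x - u m‖ₑ ^ 2 ∂gaussianReal m v :=
        evariance_le_lintegral_sub_const hu.continuous.aestronglyMeasurable _
    _ ≤ v * ∫⁻ x, ‖deriv (fun y => u y - u m) x‖ₑ ^ 2 ∂gaussianReal m v :=
        lintegral_sq_gaussianReal_le_lintegral_deriv hv (hu.sub contDiff_const) (sub_self _)
    _ = v * ∫⁻ x, ‖deriv u x‖ₑ ^ 2 ∂gaussianReal m v := by simp only [deriv_sub_const]

end GaussianPoincareReal

section GaussianPoincare

open ProbabilityTheory Module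

variable {E : Type*} [NormedAddCommGroup E] [InnerProductSpace ℝ E]

theorem sum_enorm_sq_inner {ι : Type*} [Fintype ι] (b : OrthonormalBasis ι ℝ E) (x : E) :
    ∑ i, ‖inner ℝ x (b i)‖ₑ ^ 2 = ‖x‖ₑ ^ 2 := by
  simp only [← ofReal_norm, ← ENNReal.ofReal_pow (norm_nonneg _)]
  rw [← ENNReal.ofReal_sum_of_nonneg fun i _ => sq_nonneg _, b.sum_sq_norm_inner_left]

variable [FiniteDimensional ℝ E]

theorem continuous_gradient {f : E → ℝ} (hf : ContDiff ℝ 1 f) : Continuous (∇ f) :=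
  (InnerProductSpace.toDual ℝ E).symm.continuous.comp (hf.continuous_fderiv one_ne_zero)

theorem hasDerivAt_comp_sum_update {ι : Type*} [Fintype ι] [DecidableEq ι] (b : ι → E) {g : E → ℝ}
    (hg : Differentiable ℝ g) (x : ι → ℝ) (i : ι) (s : ℝ) :
    HasDerivAt (fun t => g (∑ j, Function.update x i t j • b j))
      (inner ℝ (∇ g (∑ j, Function.update x i s j • b j)) (b i)) s := by
  have hline : HasDerivAt (fun t => ∑ j, Function.update x i t j • b j) (b i) s := by
    convert! HasDerivAt.fun_sum fun j (_ : j ∈ Finset.univ) =>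
      (hasDerivAt_pi.1 (hasDerivAt_update x i s) j).smul_const (b j) using 1
    simp [Pi.single_apply]
  rw [inner_gradient_left]
  exact (hg _).hasFDerivAt.comp_hasDerivAt s hline

variable [MeasurableSpace E] [BorelSpace E]

theorem measurePreserving_stdGaussian : MeasurePreserving
    (fun x : Fin (finrank ℝ E) → ℝ => ∑ i, x i • stdOrthonormalBasis ℝ E i)
    (Measure.pi fun _ => gaussianReal 0 1) (stdGaussian E) :=
  ⟨by fun_prop, rfl⟩

theorem evariance_stdGaussian_le_lintegral_gradient {g : E → ℝ} (hg : ContDiff ℝ 1 g)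
    (hL : MemLp g 2 (stdGaussian E)) :
    evariance g (stdGaussian E) ≤ ∫⁻ x, ‖∇ g x‖ₑ ^ 2 ∂stdGaussian E := by
  set L := fun x : Fin (finrank ℝ E) → ℝ => ∑ i, x i • stdOrthonormalBasis ℝ E i with hLdef
  have hpres : MeasurePreserving L _ (stdGaussian E) := measurePreserving_stdGaussian
  have hgL : ContDiff ℝ 1 (g ∘ L) := hg.comp (by fun_prop)
  have hgrad : Measurable (∇ g) := (continuous_gradient hg).measurable
  have hpartial : ∀ i, Measurable fun x =>
    ‖inner ℝ (∇ g (L x)) (stdOrthonormalBasis ℝ E i)‖ₑ ^ 2 := by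
    intro i
    have := hgrad.comp hpres.measurable
    fun_prop
  calc evariance g (stdGaussian E) = evariance (g ∘ L) (Measure.pi fun _ => gaussianReal 0 1) :=
        (evariance_comp_measurePreserving hpres hg.continuous.measurable).symm
    _ ≤ ∑ i, ∫⁻ x, evariance (fun s => g (L (Function.update x i s))) (gaussianReal 0 1)
          ∂Measure.pi fun _ => gaussianReal 0 1 :=
        evariance_pi_le_sum hgL.continuous.measurable (hL.comp_measurePreserving hpres)
    _ ≤ ∑ i, ∫⁻ x, ∫⁻ s, ‖inner ℝ (∇ g (L (Function.update x i s)))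
          (stdOrthonormalBasis ℝ E i)‖ₑ ^ 2 ∂gaussianReal 0 1
          ∂Measure.pi fun _ => gaussianReal 0 1 := by
        refine Finset.sum_le_sum fun i _ => lintegral_mono fun x => ?_
        have hsec : ContDiff ℝ 1 fun s => g (L (Function.update x i s)) :=
          hgL.comp (contDiff_update 1 x i)
        have := evariance_gaussianReal_le_lintegral_deriv 0 1 hsec
        simpa [(hasDerivAt_comp_sum_update _ (hg.differentiable one_ne_zero) _ _ _).deriv,
          hLdef] using this
    _ = ∑ i, ∫⁻ x, ‖inner ℝ (∇ g (L x)) (stdOrthonormalBasis ℝ E i)‖ₑ ^ 2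
          ∂Measure.pi fun _ => gaussianReal 0 1 :=
        Finset.sum_congr rfl fun i _ => lintegral_pi_lintegral_update i (hpartial i)
    _ = ∫⁻ x, ‖∇ g x‖ₑ ^ 2 ∂stdGaussian E := by
        rw [← lintegral_finsetSum _ fun i _ => hpartial i]
        simp only [sum_enorm_sq_inner]
        exact hpres.lintegral_comp (hgrad.enorm.pow_const 2)

theorem integrable_exp_neg_mul_norm_sq {c : ℝ} (hc : 0 < c) :
    Integrable fun x : E => Real.exp (-c * ‖x‖ ^ 2) := by
  have := (GaussianFourier.integrable_cexp_neg_mul_sq_norm_add (V := E) (b := c)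
    (by simpa using hc) 0 0).norm
  simpa [Complex.norm_exp, ← Complex.ofReal_pow] using this

theorem stdGaussian_eq_withDensity : ∃ K : ℝ, 0 < K ∧ stdGaussian E =
    volume.withDensity fun x => ENNReal.ofReal (K * Real.exp (-(1 / 2) * ‖x‖ ^ 2)) := by
  set K : ℝ := ((2 * Real.pi) ^ (finrank ℝ E / 2 : ℝ))⁻¹
  have hK : 0 < K := by positivity
  have hint : Integrable fun x : E => K * Real.exp (-(1 / 2) * ‖x‖ ^ 2) :=
    (integrable_exp_neg_mul_norm_sq one_half_pos).const_mul K
  have := isFiniteMeasure_withDensity_ofReal hint.2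
  refine ⟨K, hK, Measure.ext_of_charFun (funext fun t => ?_)⟩
  have hfourier := GaussianFourier.integral_cexp_neg_mul_sq_norm_add (V := E) (b := 1 / 2)
    (by norm_num) Complex.I t
  have hnormalize : (K : ℂ) * (Real.pi / (1 / 2)) ^ (finrank ℝ E / 2 : ℂ) = 1 := by
    have hpow : ((Real.pi : ℂ) / (1 / 2)) ^ (finrank ℝ E / 2 : ℂ) = ((K⁻¹ : ℝ) : ℂ) := by
      rw [inv_inv, Complex.ofReal_cpow (by positivity)]
      push_cast
      ring_nf
    rw [hpow, ← Complex.ofReal_mul, mul_inv_cancel₀ hK.ne', Complex.ofReal_one]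
  have hintegrand : ∀ x : E, (ENNReal.ofReal (K * Real.exp (-(1 / 2) * ‖x‖ ^ 2))).toReal •
      Complex.exp (inner ℝ x t * Complex.I) =
        K * Complex.exp (-(1 / 2) * ‖x‖ ^ 2 + Complex.I * inner ℝ t x) := fun x => by
    rw [ENNReal.toReal_ofReal (by positivity), Complex.real_smul, Complex.exp_add,
      real_inner_comm]
    push_cast
    ring_nf
  rw [charFun_stdGaussian, charFun_apply,
    integral_withDensity_eq_integral_toReal_smul (by fun_prop) (by simp)]
  simp only [hintegrand]
  rw [integral_const_mul, hfourier, ← mul_assoc, hnormalize, Complex.I_sq]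
  ring_nf

end GaussianPoincare

section GroundState

open ProbabilityTheory

variable {E : Type*} [NormedAddCommGroup E] [InnerProductSpace ℝ E]

theorem hasGradientAt_mul_exp_norm_sq [CompleteSpace E] {f : E → ℝ} {f' x : E}
    (hf : HasGradientAt f f' x) (a : ℝ) :
    HasGradientAt (fun y => f y * Real.exp (a * ‖y‖ ^ 2))
      (Real.exp (a * ‖x‖ ^ 2) • (f' + (2 * a * f x) • x)) x := by
  rw [hasGradientAt_iff_hasFDerivAt] at hf ⊢
  convert! hf.mul ((hasStrictFDerivAt_norm_sq x).hasFDerivAt.const_mul a).exp using 1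
  ext v
  simp only [smul_add, map_add, map_smul, add_apply, smul_apply, smul_eq_mul, nsmul_eq_mul,
    InnerProductSpace.toDual_apply_apply, coe_innerSL_apply, Nat.cast_ofNat]
  ring

variable [FiniteDimensional ℝ E] [MeasurableSpace E] [BorelSpace E]

theorem lintegral_enorm_sq_exp_smul_withDensity {F : Type*} [NormedAddCommGroup F]
    [NormedSpace ℝ F] [MeasurableSpace F] [BorelSpace F] (K : ℝ) {G : E → F} (hG : Measurable G) :
    ∫⁻ x, ‖Real.exp (1 / 4 * ‖x‖ ^ 2) • G x‖ₑ ^ 2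
      ∂volume.withDensity (fun x => ENNReal.ofReal (K * Real.exp (-(1 / 2) * ‖x‖ ^ 2))) =
      ENNReal.ofReal K * ∫⁻ x, ‖G x‖ₑ ^ 2 := by
  simp only [enorm_smul]
  rw [lintegral_withDensity_eq_lintegral_mul₀ (by fun_prop) (by fun_prop),
    ← lintegral_const_mul _ (by fun_prop)]
  refine lintegral_congr fun x => ?_
  have hcancel : Real.exp (-(1 / 2) * ‖x‖ ^ 2) * Real.exp (1 / 4 * ‖x‖ ^ 2) ^ 2 = 1 := by
    rw [← Real.exp_nat_mul, ← Real.exp_add, ← Real.exp_zero]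
    congr 1
    push_cast
    ring
  rw [Pi.mul_apply, Real.enorm_of_nonneg (Real.exp_nonneg _), mul_pow, ← mul_assoc,
    ← ENNReal.ofReal_pow (Real.exp_nonneg _), ← ENNReal.ofReal_mul' (by positivity), mul_assoc K,
    hcancel, mul_one]

theorem integral_mul_exp_withDensity {K : ℝ} (hK : 0 ≤ K) (f : E → ℝ) :
    ∫ x, f x * Real.exp (1 / 4 * ‖x‖ ^ 2)
      ∂volume.withDensity (fun x => ENNReal.ofReal (K * Real.exp (-(1 / 2) * ‖x‖ ^ 2))) =
      K * ∫ x, f x * Real.exp (-(1 / 4) * ‖x‖ ^ 2) := by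
  rw [integral_withDensity_eq_integral_toReal_smul (by fun_prop) (by simp), ← integral_const_mul]
  refine integral_congr_ae (ae_of_all _ fun x => ?_)
  have hexp : Real.exp (-(1 / 2) * ‖x‖ ^ 2) * Real.exp (1 / 4 * ‖x‖ ^ 2) =
      Real.exp (-(1 / 4) * ‖x‖ ^ 2) := by
    rw [← Real.exp_add]
    ring_nf
  simp only [ENNReal.toReal_ofReal (mul_nonneg hK (Real.exp_nonneg _)), smul_eq_mul, ← hexp]
  ring

theorem lintegral_enorm_sq_le_of_integral_mul_exp_eq_zero {f : E → ℝ} (hf : ContDiff ℝ 1 f)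
    (hL : MemLp f 2) (hground : ∫ x, f x * Real.exp (-(1 / 4) * ‖x‖ ^ 2) = 0) :
    ∫⁻ x, ‖f x‖ₑ ^ 2 ≤ ∫⁻ x, ‖∇ f x + (f x / 2) • x‖ₑ ^ 2 := by
  obtain ⟨K, hK, hγ⟩ := stdGaussian_eq_withDensity (E := E)
  set g : E → ℝ := fun x => f x * Real.exp (1 / 4 * ‖x‖ ^ 2)
  have hg : ContDiff ℝ 1 g := hf.mul (((contDiff_norm_sq ℝ).const_smul (1 / 4 : ℝ)).exp)
  have hgrad : ∀ x, ∇ g x = Real.exp (1 / 4 * ‖x‖ ^ 2) • (∇ f x + (f x / 2) • x) := fun x => by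
    rw [(hasGradientAt_mul_exp_norm_sq
      ((hf.differentiable one_ne_zero x).hasGradientAt) (1 / 4)).gradient]
    ring_nf
  have hgsq : ∫⁻ x, ‖g x‖ₑ ^ 2 ∂stdGaussian E = ENNReal.ofReal K * ∫⁻ x, ‖f x‖ₑ ^ 2 := by
    rw [hγ, ← lintegral_enorm_sq_exp_smul_withDensity K hf.continuous.measurable]
    simp only [smul_eq_mul, g, mul_comm]
  have hgmean : ∫ x, g x ∂stdGaussian E = 0 := by
    rw [hγ, integral_mul_exp_withDensity hK.le, hground, mul_zero]
  have hgL : MemLp g 2 (stdGaussian E) := by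
    rw [memLp_two_iff_lintegral_enorm_sq_lt_top hg.continuous.aestronglyMeasurable, hgsq]
    exact ENNReal.mul_lt_top ENNReal.ofReal_lt_top
      ((memLp_two_iff_lintegral_enorm_sq_lt_top hL.1).1 hL)
  have hpoincare : ∫⁻ x, ‖g x‖ₑ ^ 2 ∂stdGaussian E ≤ ∫⁻ x, ‖∇ g x‖ₑ ^ 2 ∂stdGaussian E := by
    rw [lintegral_enorm_sq_eq_evariance_add hgL.1, hgmean]
    simpa using evariance_stdGaussian_le_lintegral_gradient hg hgL
  have hmeas : Measurable fun x => ∇ f x + (f x / 2) • x :=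
    ((continuous_gradient hf).add ((hf.continuous.div_const 2).smul continuous_id)).measurable
  simp only [hgsq, hgrad] at hpoincare
  rw [hγ, lintegral_enorm_sq_exp_smul_withDensity K hmeas] at hpoincare
  exact (ENNReal.mul_le_mul_iff_right (by simpa using hK) ENNReal.ofReal_ne_top).1 hpoincare

end GroundState

section EulerField

open Module

variable {E : Type*} [NormedAddCommGroup E] [NormedSpace ℝ E] [FiniteDimensional ℝ E]
  [MeasurableSpace E] [BorelSpace E]
  {F : Type*} [NormedAddCommGroup F] [NormedSpace ℝ F]

theorem integral_fderiv_apply_self (μ : Measure E) [μ.IsAddHaarMeasure] {h : E → F}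
    (hh : ContDiff ℝ 1 h) (hint : Integrable h μ) (hnorm : Integrable (fun x => ‖x‖ * ‖h x‖) μ)
    (hfderiv : Integrable (fun x => ‖x‖ * ‖fderiv ℝ h x‖) μ) :
    ∫ x, fderiv ℝ h x x ∂μ = -((finrank ℝ E : ℝ) • ∫ x, h x ∂μ) := by
  set b := finBasis ℝ E
  let coord : Fin (finrank ℝ E) → E →L[ℝ] ℝ := fun i => (b.coord i).toContinuousLinearMap
  have hcoord : ∀ i (v : E → F), Continuous v → Integrable (fun x => ‖x‖ * ‖v x‖) μ →
      Integrable (fun x => coord i x • v x) μ := fun i v hv hi => by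
    refine (hi.const_mul ‖coord i‖).mono' (by fun_prop) (ae_of_all _ fun x => ?_)
    rw [norm_smul, ← mul_assoc]
    gcongr
    exact (coord i).le_opNorm x
  have hpartial : ∀ i, Integrable (fun x => coord i x • fderiv ℝ h x (b i)) μ := fun i => by
    refine hcoord i _ (by fun_prop) ((hfderiv.const_mul ‖b i‖).mono' (by fun_prop)
      (ae_of_all _ fun x => ?_))
    rw [Real.norm_of_nonneg (by positivity), mul_left_comm]
    gcongr
    rw [mul_comm]
    exact (fderiv ℝ h x).le_opNorm (b i)
  have hderiv : ∀ i x, fderiv ℝ (coord i) x (b i) = 1 := fun i x => by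
    rw [(coord i).fderiv]
    simp [coord]
  have hparts : ∀ i, ∫ x, coord i x • fderiv ℝ h x (b i) ∂μ = -∫ x, h x ∂μ := fun i => by
    rw [integral_smul_fderiv_eq_neg_fderiv_smul_of_integrable (by simpa only [hderiv, one_smul])
      (hpartial i) (hcoord i h hh.continuous hnorm)
      (fun _ _ => (coord i).differentiableAt) (fun _ _ => hh.differentiable one_ne_zero _)]
    simp only [hderiv, one_smul]
  have hexpand : ∀ x, fderiv ℝ h x x = ∑ i, coord i x • fderiv ℝ h x (b i) := fun x => by
    nth_rw 2 [← b.sum_repr x]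
    simp only [map_sum, map_smul]
    rfl
  simp only [hexpand]
  rw [integral_finsetSum _ fun i _ => hpartial i, Finset.sum_congr rfl fun i _ => hparts i]
  simp [Nat.cast_smul_eq_nsmul]

end EulerField

section Uncertainty

open Module

theorem lintegral_enorm_sq_eq_ofReal {α F : Type*} [MeasurableSpace α] [NormedAddCommGroup F]
    {μ : Measure α} {g : α → F} (hg : Integrable (fun x => ‖g x‖ ^ 2) μ) :
    ∫⁻ x, ‖g x‖ₑ ^ 2 ∂μ = ENNReal.ofReal (∫ x, ‖g x‖ ^ 2 ∂μ) := by
  rw [ofReal_integral_eq_lintegral_ofReal hg (ae_of_all _ fun _ => by positivity)]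
  simp only [ENNReal.ofReal_pow (norm_nonneg _), ofReal_norm]

variable {E : Type*} [NormedAddCommGroup E] [InnerProductSpace ℝ E]

theorem norm_gradient [CompleteSpace E] (f : E → ℝ) (x : E) : ‖∇ f x‖ = ‖fderiv ℝ f x‖ :=
  (InnerProductSpace.toDual ℝ E).symm.norm_map _

theorem gradient_comp_smul [CompleteSpace E] (f : E → ℝ) (c : ℝ) (x : E) :
    ∇ (fun y => f (c • y)) x = c • ∇ f (c • x) := by
  simp only [gradient, fderiv_comp_smul, map_smulₛₗ, conj_trivial]

variable [FiniteDimensional ℝ E] [MeasurableSpace E] [BorelSpace E]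

theorem integrable_norm_mul_abs_mul_norm_gradient {f : E → ℝ} (hf : ContDiff ℝ 1 f)
    (hx : Integrable fun x => f x ^ 2 * ‖x‖ ^ 2) (hgrad : Integrable fun x => ‖∇ f x‖ ^ 2) :
    Integrable fun x => ‖x‖ * (|f x| * ‖∇ f x‖) := by
  have hcont := continuous_gradient hf
  have hcont' := hf.continuous
  refine (hx.add hgrad).mono' (by fun_prop) (ae_of_all _ fun x => ?_)
  have hyoung := two_mul_le_add_sq (|f x| * ‖x‖) ‖∇ f x‖
  rw [mul_pow, sq_abs] at hyoung
  have hpos : 0 ≤ ‖x‖ * (|f x| * ‖∇ f x‖) := by positivity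
  rw [Real.norm_of_nonneg hpos, Pi.add_apply]
  linarith

theorem two_mul_integral_mul_inner_gradient {f : E → ℝ} (hf : ContDiff ℝ 1 f)
    (hL : Integrable fun x => f x ^ 2) (hx : Integrable fun x => f x ^ 2 * ‖x‖ ^ 2)
    (hgrad : Integrable fun x => ‖∇ f x‖ ^ 2) :
    2 * ∫ x, f x * inner ℝ (∇ f x) x = -(finrank ℝ E * ∫ x, f x ^ 2) := by
  have hfderiv : ∀ x, fderiv ℝ (fun y => f y ^ 2) x = (2 * f x) • fderiv ℝ f x := fun x => by
    simpa using fderiv_fun_pow 2 (hf.differentiable one_ne_zero x)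
  rw [← smul_eq_mul (finrank ℝ E : ℝ), ← integral_fderiv_apply_self volume (hf.pow 2) hL,
    ← integral_const_mul]
  · simp only [hfderiv, smul_apply, inner_gradient_left, smul_eq_mul, mul_assoc]
  · refine (hL.add hx).mono' (hf.pow 2 |>.continuous.norm |> continuous_norm.mul
      |>.aestronglyMeasurable) (ae_of_all _ fun x => ?_)
    rw [norm_mul, norm_norm, norm_norm, Real.norm_of_nonneg (sq_nonneg _), Pi.add_apply]
    nlinarith [mul_nonneg (sq_nonneg (f x)) (sq_nonneg (‖x‖ - 1)),
      mul_nonneg (sq_nonneg (f x)) (norm_nonneg x)]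
  · convert (integrable_norm_mul_abs_mul_norm_gradient hf hx hgrad).const_mul 2 using 2 with x
    rw [hfderiv, norm_smul, norm_gradient, norm_mul, Real.norm_eq_abs (f x), Real.norm_two]
    ring

theorem integral_sq_le_of_integral_mul_exp_eq_zero {f : E → ℝ} (hf : ContDiff ℝ 1 f)
    (hL : Integrable fun x => f x ^ 2) (hx : Integrable fun x => f x ^ 2 * ‖x‖ ^ 2)
    (hgrad : Integrable fun x => ‖∇ f x‖ ^ 2)
    (hground : ∫ x, f x * Real.exp (-(1 / 4) * ‖x‖ ^ 2) = 0) :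
    (finrank ℝ E + 2) / 2 * ∫ x, f x ^ 2 ≤
      (∫ x, ‖∇ f x‖ ^ 2) + 1 / 4 * ∫ x, f x ^ 2 * ‖x‖ ^ 2 := by
  have hcross : Integrable fun x => f x * inner ℝ (∇ f x) x := by
    have hcont := continuous_gradient hf
    have hcont' := hf.continuous
    refine (integrable_norm_mul_abs_mul_norm_gradient hf hx hgrad).mono' (by fun_prop)
      (ae_of_all _ fun x => ?_)
    rw [norm_mul, Real.norm_eq_abs, mul_left_comm, mul_comm ‖x‖]
    gcongr
    exact norm_inner_le_norm _ _
  have hexpand : ∀ x, ‖∇ f x + (f x / 2) • x‖ ^ 2 =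
      ‖∇ f x‖ ^ 2 + f x * inner ℝ (∇ f x) x + 1 / 4 * (f x ^ 2 * ‖x‖ ^ 2) := fun x => by
    rw [norm_add_sq_real, inner_smul_right, norm_smul, mul_pow, Real.norm_eq_abs, sq_abs]
    ring
  have hsq : Integrable fun x => ‖∇ f x + (f x / 2) • x‖ ^ 2 := by
    simp only [hexpand]
    exact (hgrad.add hcross).add (hx.const_mul _)
  have hgap := lintegral_enorm_sq_le_of_integral_mul_exp_eq_zero hf
    ((memLp_two_iff_integrable_sq hf.continuous.aestronglyMeasurable).2 hL) hground
  rw [lintegral_enorm_sq_eq_ofReal hsq, lintegral_enorm_sq_eq_ofReal (by simpa using hL),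
    ENNReal.ofReal_le_ofReal_iff (integral_nonneg fun x => by positivity)] at hgap
  simp only [hexpand, Real.norm_eq_abs, sq_abs] at hgap
  rw [integral_add (by exact hgrad.add hcross) (hx.const_mul _), integral_add hgrad hcross,
    integral_const_mul] at hgap
  linarith [two_mul_integral_mul_inner_gradient hf hL hx hgrad]

theorem mul_integral_sq_le_of_integral_mul_exp_eq_zero {f : E → ℝ} (hf : ContDiff ℝ 1 f)
    (hL : Integrable fun x => f x ^ 2) (hx : Integrable fun x => f x ^ 2 * ‖x‖ ^ 2)
    (hgrad : Integrable fun x => ‖∇ f x‖ ^ 2) {a : ℝ} (ha : 0 < a)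
    (hground : ∫ x, f x * Real.exp (-a * ‖x‖ ^ 2) = 0) :
    (finrank ℝ E + 2) * (2 * a) * ∫ x, f x ^ 2 ≤
      (∫ x, ‖∇ f x‖ ^ 2) + (2 * a) ^ 2 * ∫ x, f x ^ 2 * ‖x‖ ^ 2 := by
  obtain ⟨s, hs, hsa⟩ : ∃ s : ℝ, 0 < s ∧ s ^ 2 = 4 * a :=
    ⟨√(4 * a), by positivity, Real.sq_sqrt (by positivity)⟩
  have hs' : s⁻¹ ≠ 0 := by positivity
  set κ := |s ^ finrank ℝ E|
  have hκ : 0 < κ := by positivity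
  have hscale : ∀ k : E → ℝ, ∫ x, k (s⁻¹ • x) = κ * ∫ x, k x := fun k =>
    Measure.integral_comp_inv_smul volume k s
  have hnorm : ∀ x : E, ‖x‖ ^ 2 = 4 * a * ‖s⁻¹ • x‖ ^ 2 := fun x => by
    rw [norm_smul, mul_pow, Real.norm_eq_abs, sq_abs, inv_pow, hsa]
    field_simp
  have hgrad_sq : ∀ x, ‖∇ (fun y => f (s⁻¹ • y)) x‖ ^ 2 =
      (4 * a)⁻¹ * ‖∇ f (s⁻¹ • x)‖ ^ 2 := fun x => by
    rw [gradient_comp_smul, norm_smul, mul_pow, Real.norm_eq_abs, sq_abs, inv_pow, hsa]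
  have hx_sq : ∀ x, f (s⁻¹ • x) ^ 2 * ‖x‖ ^ 2 =
      4 * a * (f (s⁻¹ • x) ^ 2 * ‖s⁻¹ • x‖ ^ 2) := fun x => by
    rw [hnorm]
    ring
  have hunit := integral_sq_le_of_integral_mul_exp_eq_zero (f := fun x => f (s⁻¹ • x))
    (hf.comp (contDiff_const_smul s⁻¹)) (hL.comp_smul hs')
    (by simpa only [hx_sq] using (hx.comp_smul hs').const_mul (4 * a))
    (by simpa only [hgrad_sq] using (hgrad.comp_smul hs').const_mul (4 * a)⁻¹) <| by
      rw [← mul_zero κ, ← hground, ← hscale]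
      refine integral_congr_ae (ae_of_all _ fun x => ?_)
      beta_reduce
      rw [hnorm x]
      ring_nf
  simp only [hgrad_sq, hx_sq, integral_const_mul] at hunit
  rw [hscale fun y => f y ^ 2, hscale fun y => ‖∇ f y‖ ^ 2,
    hscale fun y => f y ^ 2 * ‖y‖ ^ 2] at hunit
  refine le_of_mul_le_mul_left ?_ (show 0 < κ / (4 * a) by positivity)
  convert! hunit using 1
  · field_simp
    ring
  · field_simp
    ring

theorem lemma3p1_general {f : E → ℝ} (hf : ContDiff ℝ 1 f)
    (hL : Integrable fun x => f x ^ 2) (hx : Integrable fun x => f x ^ 2 * ‖x‖ ^ 2)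
    (hgrad : Integrable fun x => ‖∇ f x‖ ^ 2)
    (hortho : ∀ a : ℝ, 0 < a → ∫ x, f x * Real.exp (-a * ‖x‖ ^ 2) = 0) :
    ((finrank ℝ E + 2 : ℝ) / 2) ^ 2 * (∫ x, f x ^ 2) ^ 2 ≤
      (∫ x, ‖∇ f x‖ ^ 2) * ∫ x, f x ^ 2 * ‖x‖ ^ 2 := by
  have hA : 0 ≤ ∫ x, ‖∇ f x‖ ^ 2 := by positivity
  have hB : 0 ≤ ∫ x, f x ^ 2 * ‖x‖ ^ 2 := by positivity
  have hquad : ∀ t : ℝ, 0 ≤ (∫ x, f x ^ 2 * ‖x‖ ^ 2) * (t * t) +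
      -((finrank ℝ E + 2) * ∫ x, f x ^ 2) * t + ∫ x, ‖∇ f x‖ ^ 2 := fun t => by
    rcases le_or_gt t 0 with ht | ht
    · have hlin : 0 ≤ ((finrank ℝ E + 2) * ∫ x, f x ^ 2) * -t :=
        mul_nonneg (by positivity) (neg_nonneg.2 ht)
      nlinarith [mul_nonneg hB (mul_self_nonneg t)]
    · have hgap := mul_integral_sq_le_of_integral_mul_exp_eq_zero hf hL hx hgrad (half_pos ht)
        (hortho _ (half_pos ht))
      rw [mul_div_cancel₀ t two_ne_zero] at hgap
      linarith
  have hdiscrim := discrim_le_zero hquad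
  rw [discrim] at hdiscrim
  linarith

end Uncertainty

section Sphere

open Module Metric

variable {E : Type*} [NormedAddCommGroup E] [NormedSpace ℝ E] [FiniteDimensional ℝ E]
  [MeasurableSpace E] [BorelSpace E] (μ : Measure E) [μ.IsAddHaarMeasure]
  {F : Type*} [NormedAddCommGroup F] [NormedSpace ℝ F]

theorem measurePreserving_smul_sphere_prod [Nontrivial E] : MeasurePreserving
    (fun p : sphere (0 : E) 1 × Set.Ioi (0 : ℝ) => (p.2 : ℝ) • (p.1 : E))
    (μ.toSphere.prod (.volumeIoiPow (finrank ℝ E - 1))) μ := by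
  have hcoe := measurePreserving_subtype_coe (μa := μ) (measurableSet_singleton (0 : E)).compl
  rw [restrict_compl_singleton] at hcoe
  exact hcoe.comp (μ.measurePreserving_homeomorphUnitSphereProd.symm
    (homeomorphUnitSphereProd E).toMeasurableEquiv)

theorem measurableEmbedding_smul_sphere_prod : MeasurableEmbedding
    (fun p : sphere (0 : E) 1 × Set.Ioi (0 : ℝ) => (p.2 : ℝ) • (p.1 : E)) :=
  (MeasurableEmbedding.subtype_coe (measurableSet_singleton (0 : E)).compl).comp
    (homeomorphUnitSphereProd E).symm.measurableEmbedding

theorem integral_smul_comp_norm_eq_zero [Nontrivial E] {f : E → F}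
    (hf : ∀ r : ℝ, 0 < r → ∫ σ : sphere (0 : E) 1, f (r • (σ : E)) ∂μ.toSphere = 0)
    (φ : ℝ → ℝ) : ∫ x, φ ‖x‖ • f x ∂μ = 0 := by
  by_cases hint : Integrable (fun x => φ ‖x‖ • f x) μ
  · have hpolar := measurePreserving_smul_sphere_prod μ
    have hemb := measurableEmbedding_smul_sphere_prod (E := E)
    have hint' := (hpolar.integrable_comp_emb hemb).2 hint
    rw [← hpolar.integral_comp hemb]
    refine (integral_prod_symm _ hint').trans ?_
    refine integral_eq_zero_of_ae (ae_of_all _ fun ⟨r, hr⟩ => ?_)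
    have hnorm : ∀ σ : sphere (0 : E) 1, ‖r • (σ : E)‖ = r := fun σ => by
      rw [norm_smul, Real.norm_of_nonneg hr.le, norm_eq_of_mem_sphere, mul_one]
    simp only [Function.comp_apply, hnorm, integral_smul, hf r hr, smul_zero, Pi.zero_apply]
  · exact integral_undef hint

theorem measurePreserving_neg_sphere :
    MeasurePreserving (fun σ : sphere (0 : E) 1 => -σ) μ.toSphere μ.toSphere := by
  refine ⟨continuous_neg.measurable, Measure.ext fun s hs => ?_⟩
  have himage : ((↑) '' ((fun σ : sphere (0 : E) 1 => -σ) ⁻¹' s) : Set E) = -((↑) '' s) := by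
    ext x
    simp only [Set.mem_image, Set.mem_preimage, Set.mem_neg]
    exact ⟨fun ⟨σ, hσ, hx⟩ => ⟨-σ, hσ, by simp [hx]⟩,
      fun ⟨σ, hσ, hx⟩ => ⟨-σ, by simpa using hσ, by simp [hx]⟩⟩
  rw [Measure.map_apply continuous_neg.measurable hs, Measure.toSphere_apply' _ hs,
    Measure.toSphere_apply' _ (continuous_neg.measurable hs), himage, Set.smul_neg,
    Measure.measure_neg]

theorem integral_sphere_eq_zero_of_odd {g : E → F} (hg : g.Odd) :
    ∫ σ : sphere (0 : E) 1, g σ ∂μ.toSphere = 0 := by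
  have hneg := (measurePreserving_neg_sphere μ).integral_comp
    (Homeomorph.neg (sphere (0 : E) 1)).measurableEmbedding fun σ => g σ
  simp only [coe_neg_sphere, hg _, integral_neg] at hneg
  have : IsAddTorsionFree F := .of_isTorsionFree ℝ F
  exact self_eq_neg.1 hneg.symm

end Sphere

section LinearGaussian

open Module Metric

variable {E : Type*} [NormedAddCommGroup E] [InnerProductSpace ℝ E]

/-- The linear function `⟪b, ·⟫` damped by the Gaussian `e^{-a|x|²}`. On `ℝ^N` these are the
functions `gaussProfile`, the extremisers of the uncertainty inequality. -/
noncomputable def linearGaussian (b : E) (a : ℝ) (x : E) : ℝ :=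
  inner ℝ b x * Real.exp (-a * ‖x‖ ^ 2)

theorem linearGaussian_sq (b : E) (a : ℝ) (x : E) :
    linearGaussian b a x ^ 2 = inner ℝ b x ^ 2 * Real.exp (-(2 * a) * ‖x‖ ^ 2) := by
  rw [linearGaussian, mul_pow, ← Real.exp_nat_mul]
  push_cast
  ring_nf

theorem odd_linearGaussian (b : E) (a : ℝ) : (linearGaussian b a).Odd := fun x => by
  simp [linearGaussian]

theorem contDiff_linearGaussian (b : E) (a : ℝ) {n : WithTop ℕ∞} :
    ContDiff ℝ n (linearGaussian b a) :=
  (contDiff_const.inner ℝ contDiff_id).mul (contDiff_const.mul (contDiff_norm_sq ℝ)).exp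

theorem gradient_linearGaussian [CompleteSpace E] (b : E) (a : ℝ) (x : E) :
    ∇ (linearGaussian b a) x =
      Real.exp (-a * ‖x‖ ^ 2) • (b + (2 * -a * inner ℝ b x) • x) := by
  have hinner : HasGradientAt (fun y : E => inner ℝ b y) b x :=
    hasGradientAt_iff_hasFDerivAt.2 (InnerProductSpace.toDual ℝ E b).hasFDerivAt
  exact (hasGradientAt_mul_exp_norm_sq hinner (-a)).gradient

theorem norm_gradient_linearGaussian_sq [CompleteSpace E] (b : E) (a : ℝ) (x : E) :
    ‖∇ (linearGaussian b a) x‖ ^ 2 = ‖b‖ ^ 2 * Real.exp (-(2 * a) * ‖x‖ ^ 2) -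
      4 * a * linearGaussian b a x ^ 2 + 4 * a ^ 2 * (linearGaussian b a x ^ 2 * ‖x‖ ^ 2) := by
  rw [gradient_linearGaussian, norm_smul, Real.norm_of_nonneg (Real.exp_nonneg _), mul_pow,
    norm_add_sq_real, inner_smul_right, norm_smul, mul_pow, Real.norm_eq_abs, sq_abs,
    linearGaussian_sq, ← Real.exp_nat_mul]
  push_cast
  ring_nf

theorem linearGaussian_mul_inner_gradient [CompleteSpace E] (b : E) (a : ℝ) (x : E) :
    linearGaussian b a x * inner ℝ (∇ (linearGaussian b a) x) x =
      linearGaussian b a x ^ 2 - 2 * a * (linearGaussian b a x ^ 2 * ‖x‖ ^ 2) := by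
  rw [gradient_linearGaussian, real_inner_smul_left, inner_add_left, real_inner_smul_left,
    real_inner_self_eq_norm_sq, linearGaussian]
  ring

theorem linearGaussian_smul_sq_of_norm_eq_one (b : E) (a R : ℝ) {x : E} (hx : ‖x‖ = 1) :
    linearGaussian b a (R • x) ^ 2 = R ^ 2 * Real.exp (-(2 * a) * R ^ 2) * inner ℝ b x ^ 2 := by
  rw [linearGaussian_sq, norm_smul, hx, mul_one, Real.norm_eq_abs, sq_abs, real_inner_smul_right]
  ring

theorem isLittleO_sq_mul_exp_neg_mul_sq {c : ℝ} (hc : 0 < c) (k : ℤ) :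
    (fun R : ℝ => R ^ 2 * Real.exp (-c * R ^ 2)) =o[atTop] fun R : ℝ => R ^ k := by
  have hexp := rpow_mul_exp_neg_mul_sq_isLittleO_exp_neg hc 2
  have hpow := isLittleO_exp_neg_mul_rpow_atTop (one_half_pos (α := ℝ)) k
  simpa only [Real.rpow_two, Real.rpow_intCast] using hexp.trans hpow

theorem isLittleO_integral_sphere_linearGaussian_sq [MeasurableSpace E] (μ : Measure E) (b : E)
    {a : ℝ} (ha : 0 < a) (k : ℤ) :
    (fun R : ℝ => ∫ σ : sphere (0 : E) 1, linearGaussian b a (R • (σ : E)) ^ 2 ∂μ.toSphere)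
      =o[atTop] fun R : ℝ => R ^ k := by
  simp only [linearGaussian_smul_sq_of_norm_eq_one b a _ (norm_eq_of_mem_sphere _),
    integral_const_mul]
  exact ((isLittleO_sq_mul_exp_neg_mul_sq (mul_pos two_pos ha) k).const_mul_left _).congr_left
    fun R => mul_comm _ _

variable [FiniteDimensional ℝ E] [MeasurableSpace E] [BorelSpace E]

theorem integrable_norm_sq_pow_mul_exp_neg_mul_norm_sq {c : ℝ} (hc : 0 < c) (k : ℕ) :
    Integrable fun x : E => (‖x‖ ^ 2) ^ k * Real.exp (-c * ‖x‖ ^ 2) := by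
  refine ((integrable_exp_neg_mul_norm_sq (E := E) (half_pos hc)).const_mul
    (k.factorial / (c / 2) ^ k)).mono' (by fun_prop) (ae_of_all _ fun x => ?_)
  have hpow : (‖x‖ ^ 2) ^ k ≤ k.factorial / (c / 2) ^ k * Real.exp (c / 2 * ‖x‖ ^ 2) := by
    have hexp := Real.pow_div_factorial_le_exp (c / 2 * ‖x‖ ^ 2) (by positivity) k
    rw [mul_pow, div_le_iff₀ (by positivity)] at hexp
    rw [div_mul_eq_mul_div, le_div_iff₀ (by positivity)]
    linarith
  rw [Real.norm_of_nonneg (by positivity)]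
  calc (‖x‖ ^ 2) ^ k * Real.exp (-c * ‖x‖ ^ 2)
      ≤ k.factorial / (c / 2) ^ k * Real.exp (c / 2 * ‖x‖ ^ 2) * Real.exp (-c * ‖x‖ ^ 2) := by
        gcongr
    _ = k.factorial / (c / 2) ^ k * Real.exp (-(c / 2) * ‖x‖ ^ 2) := by
        rw [mul_assoc, ← Real.exp_add]
        ring_nf

theorem integrable_inner_sq_mul_norm_sq_pow_mul_exp (b : E) {c : ℝ} (hc : 0 < c) (k : ℕ) :
    Integrable fun x : E => inner ℝ b x ^ 2 * (‖x‖ ^ 2) ^ k * Real.exp (-c * ‖x‖ ^ 2) := by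
  refine ((integrable_norm_sq_pow_mul_exp_neg_mul_norm_sq hc (k + 1)).const_mul (‖b‖ ^ 2)).mono'
    (by fun_prop) (ae_of_all _ fun x => ?_)
  have hinner : inner ℝ b x ^ 2 ≤ ‖b‖ ^ 2 * ‖x‖ ^ 2 := by
    rw [← mul_pow, ← sq_abs]
    gcongr
    exact abs_real_inner_le_norm b x
  rw [Real.norm_of_nonneg (by positivity), pow_succ' (‖x‖ ^ 2), ← mul_assoc, ← mul_assoc]
  gcongr

theorem integrable_linearGaussian_sq (b : E) {a : ℝ} (ha : 0 < a) :
    Integrable fun x => linearGaussian b a x ^ 2 := by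
  simp only [linearGaussian_sq]
  simpa using integrable_inner_sq_mul_norm_sq_pow_mul_exp b (mul_pos two_pos ha) 0

theorem integrable_linearGaussian_sq_mul_norm_sq (b : E) {a : ℝ} (ha : 0 < a) :
    Integrable fun x => linearGaussian b a x ^ 2 * ‖x‖ ^ 2 := by
  simp only [linearGaussian_sq, mul_right_comm]
  simpa using integrable_inner_sq_mul_norm_sq_pow_mul_exp b (mul_pos two_pos ha) 1

theorem integrable_norm_gradient_linearGaussian_sq (b : E) {a : ℝ} (ha : 0 < a) :
    Integrable fun x => ‖∇ (linearGaussian b a) x‖ ^ 2 := by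
  simp only [norm_gradient_linearGaussian_sq]
  exact (((integrable_exp_neg_mul_norm_sq (mul_pos two_pos ha)).const_mul _).sub
    ((integrable_linearGaussian_sq b ha).const_mul _)).add
    ((integrable_linearGaussian_sq_mul_norm_sq b ha).const_mul _)

theorem norm_sq_mul_integral_exp_neg_mul_norm_sq (b : E) {c : ℝ} (hc : 0 < c) :
    ‖b‖ ^ 2 * ∫ x : E, Real.exp (-c * ‖x‖ ^ 2) =
      2 * c * ∫ x : E, inner ℝ b x ^ 2 * Real.exp (-c * ‖x‖ ^ 2) := by
  have hlin : ∀ x, fderiv ℝ (fun y : E => inner ℝ b y) x b = ‖b‖ ^ 2 := fun x => by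
    rw [← real_inner_self_eq_norm_sq]
    exact DFunLike.congr_fun (innerSL ℝ b).fderiv b
  have hexp : ∀ x, fderiv ℝ (fun y : E => Real.exp (-c * ‖y‖ ^ 2)) x b =
      -(2 * c) * inner ℝ b x * Real.exp (-c * ‖x‖ ^ 2) := fun x => by
    rw [((hasStrictFDerivAt_norm_sq x).hasFDerivAt.const_mul (-c)).exp.fderiv]
    simp only [smul_apply, coe_innerSL_apply, real_inner_comm, nsmul_eq_mul, Nat.cast_ofNat,
      smul_eq_mul]
    ring
  have hmoment : Integrable fun x : E => inner ℝ b x ^ 2 * Real.exp (-c * ‖x‖ ^ 2) := by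
    simpa using integrable_inner_sq_mul_norm_sq_pow_mul_exp b hc 0
  have hzero := integrable_exp_neg_mul_norm_sq (E := E) hc
  have hfirst : Integrable fun x : E => inner ℝ b x * Real.exp (-c * ‖x‖ ^ 2) := by
    refine (hzero.add hmoment).mono' (by fun_prop) (ae_of_all _ fun x => ?_)
    rw [norm_mul, Real.norm_of_nonneg (Real.exp_nonneg _), Pi.add_apply, ← one_add_mul]
    gcongr
    rw [Real.norm_eq_abs, ← sq_abs]
    nlinarith [sq_nonneg (|inner ℝ b x| - 1), abs_nonneg (inner ℝ b x)]
  have hprod : ∀ x, inner ℝ b x * fderiv ℝ (fun y : E => Real.exp (-c * ‖y‖ ^ 2)) x b =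
      -(2 * c) * (inner ℝ b x ^ 2 * Real.exp (-c * ‖x‖ ^ 2)) := fun x => by
    rw [hexp]
    ring
  have hparts := integral_mul_fderiv_eq_neg_fderiv_mul_of_integrable (v := b)
    (by simpa only [hlin] using hzero.const_mul (‖b‖ ^ 2))
    (by simpa only [hprod] using hmoment.const_mul (-(2 * c))) hfirst
    (fun _ _ => (innerSL ℝ b).differentiableAt)
    (fun x _ => ((hasStrictFDerivAt_norm_sq x).hasFDerivAt.const_mul (-c)).exp.differentiableAt)
  simp only [hlin, hprod, integral_const_mul] at hparts
  linarith

theorem integral_norm_gradient_linearGaussian_sq (b : E) {a : ℝ} (ha : 0 < a) :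
    ∫ x, ‖∇ (linearGaussian b a) x‖ ^ 2 =
      4 * a ^ 2 * ∫ x, linearGaussian b a x ^ 2 * ‖x‖ ^ 2 := by
  have hexp := (integrable_exp_neg_mul_norm_sq (E := E) (mul_pos two_pos ha)).const_mul (‖b‖ ^ 2)
  have hL := (integrable_linearGaussian_sq b ha).const_mul (4 * a)
  have hx := (integrable_linearGaussian_sq_mul_norm_sq b ha).const_mul (4 * a ^ 2)
  simp only [norm_gradient_linearGaussian_sq]
  rw [integral_add (by exact hexp.sub hL) hx, integral_sub hexp hL, integral_const_mul,
    integral_const_mul, integral_const_mul,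
    norm_sq_mul_integral_exp_neg_mul_norm_sq b (mul_pos two_pos ha)]
  simp only [linearGaussian_sq]
  ring

theorem integral_linearGaussian_sq_mul_norm_sq (b : E) {a : ℝ} (ha : 0 < a) :
    4 * a * ∫ x, linearGaussian b a x ^ 2 * ‖x‖ ^ 2 =
      (finrank ℝ E + 2) * ∫ x, linearGaussian b a x ^ 2 := by
  have hL := integrable_linearGaussian_sq b ha
  have hx := integrable_linearGaussian_sq_mul_norm_sq b ha
  have heuler := two_mul_integral_mul_inner_gradient (contDiff_linearGaussian b a) hL hx
    (integrable_norm_gradient_linearGaussian_sq b ha)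
  simp only [linearGaussian_mul_inner_gradient] at heuler
  rw [integral_sub hL (hx.const_mul _), integral_const_mul] at heuler
  linarith

theorem linearGaussian_uncertainty_eq (b : E) {a : ℝ} (ha : 0 < a) :
    (∫ x, ‖∇ (linearGaussian b a) x‖ ^ 2) * (∫ x, linearGaussian b a x ^ 2 * ‖x‖ ^ 2) =
      ((finrank ℝ E + 2 : ℝ) / 2) ^ 2 * (∫ x, linearGaussian b a x ^ 2) ^ 2 := by
  rw [integral_norm_gradient_linearGaussian_sq b ha, ← mul_pow, div_mul_eq_mul_div,
    ← integral_linearGaussian_sq_mul_norm_sq b ha]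
  ring

end LinearGaussian

section TestField

theorem normD_lt_top_iff {N : ℕ} {f : RN N → ℝ} (hf : ContDiff ℝ 1 f) :
    normD f < ⊤ ↔ Integrable (fun x => f x ^ 2) ∧ Integrable (fun x => f x ^ 2 * ‖x‖ ^ 2) ∧
      Integrable fun x => ‖∇ f x‖ ^ 2 := by
  have hcont := hf.continuous
  have hgrad := continuous_gradient hf
  have hint : ∀ k : RN N → ℝ, Continuous k → (Integrable k ↔ ∫⁻ x, ‖k x‖ₑ < ⊤) := fun k hk =>
    ⟨fun h => h.2, fun h => ⟨hk.aestronglyMeasurable, h⟩⟩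
  rw [hint _ (by fun_prop), hint _ (by fun_prop), hint _ (by fun_prop), normD,
    ENNReal.rpow_lt_top_iff_of_pos one_half_pos, ENNReal.add_lt_top, ENNReal.add_lt_top, and_assoc]
  simp only [enorm_mul, enorm_pow, enorm_norm]

theorem gaussProfile_eq_linearGaussian {N : ℕ} (B₀ : ℝ) (B : Fin N → ℝ) :
    gaussProfile B₀ B = linearGaussian (WithLp.toLp 2 B) B₀ := by
  ext x
  simp only [gaussProfile, linearGaussian, PiLp.inner_apply, RCLike.inner_apply, conj_trivial,
    mul_comm (B _)]

theorem isTestField_linearGaussian {N : ℕ} (b : RN N) {a : ℝ} (ha : 0 < a) :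
    IsTestField (linearGaussian b a) where
  smooth := contDiff_linearGaussian b a
  normD_lt_top := (normD_lt_top_iff (contDiff_linearGaussian b a)).2
    ⟨integrable_linearGaussian_sq b ha, integrable_linearGaussian_sq_mul_norm_sq b ha,
      integrable_norm_gradient_linearGaussian_sq b ha⟩
  zero_mean r _ := integral_sphere_eq_zero_of_odd volume
    (g := fun x => linearGaussian b a (r • x)) fun x => by
      simp only [smul_neg, odd_linearGaussian b a _]
  decay := isLittleO_integral_sphere_linearGaussian_sq volume b ha _

end TestField

theorem lemma3p1 (N : ℕ) (hN : 1 ≤ N) :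
    (∀ f : RN N → ℝ, IsTestField f →
      (((N : ℝ) + 2) / 2) ^ 2 * (∫ x, f x ^ 2) ^ 2 ≤
        (∫ x, ‖∇ f x‖ ^ 2) * ∫ x, f x ^ 2 * ‖x‖ ^ 2) ∧
    (∀ (B₀ : ℝ) (B : Fin N → ℝ), 0 < B₀ →
      IsTestField (gaussProfile B₀ B) ∧
      (∫ x, ‖∇ (gaussProfile B₀ B) x‖ ^ 2) * (∫ x, gaussProfile B₀ B x ^ 2 * ‖x‖ ^ 2) =
        (((N : ℝ) + 2) / 2) ^ 2 * (∫ x, gaussProfile B₀ B x ^ 2) ^ 2) := by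
  refine ⟨fun f hf => ?_, fun B₀ B hB₀ => ?_⟩
  · have : Nonempty (Fin N) := ⟨⟨0, hN⟩⟩
    have hC : ContDiff ℝ 1 f := hf.smooth.of_le (by norm_cast)
    obtain ⟨hL, hx, hgrad⟩ := (normD_lt_top_iff hC).1 hf.normD_lt_top
    simpa using lemma3p1_general hC hL hx hgrad fun a _ => by
      simpa only [smul_eq_mul, mul_comm] using
        integral_smul_comp_norm_eq_zero volume hf.zero_mean fun r => Real.exp (-a * r ^ 2)
  · rw [gaussProfile_eq_linearGaussian]
    exact ⟨isTestField_linearGaussian _ hB₀, by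
      simpa using linearGaussian_uncertainty_eq (WithLp.toLp 2 B) hB₀⟩
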